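/- Let $X$ be a real $N\times n$ matrix with $N\ge n$ and $\operatorname{rank}(X)=k$, and let $X=U\,\mathrm{diag}(\sigma_1,\dots,\sigma_k)\,V^T$ be a truncated SVD ($U\in\mathbb R^{N\times k}$ and $V\in\mathbb R^{n\times k}$ with orthonormal columns, $\sigma_1\ge\dots\ge\sigma_k>0$); let $v_1,\dots,v_k$ be the columns of $V$. Let $\epsilon,\delta\in(0,1)$, let $\Phi$ be an $m\times N$ random matrix, and let $Y=\Phi X$. An $m\times N$ random matrix $\Phi$ satisfies the distributional JL property with rate $f$ if for every fixed $x\in\mathbb R^N$ and every $0<\eta<1$, $$\Pr\left[\,\left|\|\Phi x\|_2^2-\|x\|_2^2\right|>\eta\|x\|_2^2\,\right]\le 2e^{-mf(\eta)}.$$ The rate $f$ is called quadratic if $f(\eta)>0$ for all $\eta\in(0,1)$ and $f(\eta)=\Theta(\eta^2)$ as $\eta\to0^+$. Suppose that one of the following holds. (a) The entries of $\Phi$ are i.i.d. subgaussian, scaled so that $\sqrt m\,\Phi_{ij}$ has variance $1$ and $\mathbb E\,e^{t\sqrt m\,\Phi_{ij}}\le e^{ct^2/2}$ for all $t\in\mathbb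 R$ (so the entries have mean $0$), where $c\ge 0$ is a fixed constant. (b) $\Phi$ satisfies the distributional JL property with a fixed quadratic rate $f$. Then for every $\rho\in(0,1)$ there is a constant $C>0$, depending only on $\rho$ and on $c$ (in case (a)) or $f$ (in case (b)), such that whenever $\epsilon\delta\le\rho$ and $$m\ \ge\ C\,k\,\epsilon^{-2}\left(\log(1/\epsilon)+\log(1/\delta)\right),$$ with probability exceeding $1-\delta$ we have $\operatorname{rank}(Y)=k$ and, for every truncated SVD $Y=U'\,\mathrm{diag}(\sigma_1',\dots,\sigma_k')\,V'^T$ with $\sigma'_1\ge\dots\ge\sigma'_k\ge 0$ and right singular vectors $v'_1,\dots,v'_k$ (the columns of $V'$), both of the following hold. 1. For all $j=1,\dots,k$: $\ (1-\epsilon)^{1/2}\le \sigma_j'/\sigma_j\le(1+\epsilon)^{1/2}$. 2. For all $j=1,\dots,k$ for which the sign of $v_j'$ is chosen such that $\langle v_j,v_j'\rangle\ge0$: $$\|v_j-v_j'\|_2\le\min\left\{\sqrt2,\ \frac{\epsilon\sqrt{1+\epsilon}}{\sqrt{1-\epsilon}}\max_{i\ne j}\frac{\sqrt2\,\sigma_i\sigma_j}{\min_{c'\in[-1,1]}|\sigma_i^2-\sigma_j^2(1+c'\epsilon)|}\right\},$$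 where a quotient with denominator $0$ is $+\infty$ and the maximum over the empty set (the case $k=1$) is $0$. -/

import Mathlib

open MeasureTheory ProbabilityTheory Set Filter Topology Asymptotics
open scoped NNReal ENNReal Matrix

noncomputable section

/-- The Euclidean norm of a vector of real numbers. -/
def l2norm {d : ℕ} (x : Fin d → ℝ) : ℝ := ‖WithLp.toLp 2 x‖

/-- The distributional Johnson-Lindenstrauss property, with rate function `f`, of an `m × N`
random matrix `Φ` defined on the probability space `(Ω, P)`. -/
def DistributionalJL {Ω : Type*} [MeasurableSpace Ω] (P : Measure Ω) {m N : ℕ}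
    (f : ℝ → ℝ) (Φ : Ω → Matrix (Fin m) (Fin N) ℝ) : Prop :=
  ∀ x : Fin N → ℝ, ∀ ε : ℝ, 0 < ε → ε < 1 →
    P.real {ω | ε * l2norm x ^ 2 < |l2norm (Φ ω *ᵥ x) ^ 2 - l2norm x ^ 2|}
      ≤ 2 * Real.exp (-(m * f ε))

/-- `f` is positive on `(0, 1)` and quadratic in `ε` as `ε → 0`, that is, it is bounded above
and below by positive multiples of `ε ^ 2` near `0`. -/
def IsQuadraticRate (f : ℝ → ℝ) : Prop :=
  (∀ ε : ℝ, 0 < ε → ε < 1 → 0 < f ε) ∧ f =Θ[𝓝[>] 0] fun ε => ε ^ 2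

/-- The entries of the `m × N` random matrix `Φ` are i.i.d. and, multiplied by `√m`, they have
unit variance and are subgaussian with variance proxy `c`: `E exp (t ξ) ≤ exp (c t ^ 2 / 2)` for
all real `t`, where `ξ = √m Φ i j` (in particular the entries have mean zero). -/
structure IsScaledSubgaussian {Ω : Type*} [MeasurableSpace Ω] (P : Measure Ω) {m N : ℕ}
    (c : ℝ≥0) (Φ : Ω → Matrix (Fin m) (Fin N) ℝ) : Prop where
  indep : iIndepFun (fun (p : Fin m × Fin N) (ω : Ω) => Φ ω p.1 p.2) P
  identDistrib : ∀ p q : Fin m × Fin N,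
    IdentDistrib (fun ω => Φ ω p.1 p.2) (fun ω => Φ ω q.1 q.2) P P
  subgaussian : ∀ i j, HasSubgaussianMGF (fun ω => √(m : ℝ) * Φ ω i j) c P
  variance_eq_one : ∀ i j, Var[fun ω => √(m : ℝ) * Φ ω i j; P] = 1

/-- `A = U diag(σ) Vᵀ` is a singular value decomposition of `A` truncated to `k` terms: `U` and
`V` have `k` orthonormal columns and `σ` is nonnegative and in decreasing order.
(If `A` has rank `k`, then all `σ j` are positive.) -/
structure IsTruncatedSVD {a n k : ℕ} (A : Matrix (Fin a) (Fin n) ℝ)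
    (U : Matrix (Fin a) (Fin k) ℝ) (σ : Fin k → ℝ) (V : Matrix (Fin n) (Fin k) ℝ) : Prop where
  left_orthonormal : Uᵀ * U = 1
  right_orthonormal : Vᵀ * V = 1
  antitone : Antitone σ
  nonneg : ∀ j, 0 ≤ σ j
  eq_mul : A = U * Matrix.diagonal σ * Vᵀ

/-- The bound on the perturbation of the `j`-th right singular vector,
`min {√2, ε √(1+ε) / √(1-ε) max_{i ≠ j} √2 σ_i σ_j / min_{c ∈ [-1,1]} |σ_i² - σ_j² (1 + c ε)|}`,
as an extended nonnegative real: a quotient with denominator `0` is `∞`, and the maximum over the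
empty set is `0`. -/
def singularVectorBound {k : ℕ} (ε : ℝ) (σ : Fin k → ℝ) (j : Fin k) : ℝ≥0∞ :=
  min (ENNReal.ofReal √2)
    (ENNReal.ofReal (ε * √(1 + ε) / √(1 - ε)) *
      ⨆ (i : Fin k) (_ : i ≠ j), ENNReal.ofReal (√2 * σ i * σ j) /
        ⨅ c ∈ Icc (-1 : ℝ) 1, ENNReal.ofReal |σ i ^ 2 - σ j ^ 2 * (1 + c * ε)|)

/-- The sketch `Y` of a matrix with singular values `σ` and right singular vectors the columns of
`V` has rank `k`, and whichever truncated singular value decomposition of `Y` is computed, it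
preserves the singular values and the right singular vectors (with signs chosen such that
`⟨v_j, v_j'⟩ ≥ 0`). -/
def SketchPreserves {m n k : ℕ} (ε : ℝ) (σ : Fin k → ℝ) (V : Matrix (Fin n) (Fin k) ℝ)
    (Y : Matrix (Fin m) (Fin n) ℝ) : Prop :=
  Y.rank = k ∧
  ∀ (U' : Matrix (Fin m) (Fin k) ℝ) (σ' : Fin k → ℝ) (V' : Matrix (Fin n) (Fin k) ℝ),
    IsTruncatedSVD Y U' σ' V' →
      (∀ j, √(1 - ε) ≤ σ' j / σ j ∧ σ' j / σ j ≤ √(1 + ε)) ∧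
      (∀ j, 0 ≤ V.col j ⬝ᵥ V'.col j →
        ENNReal.ofReal (l2norm (V.col j - V'.col j)) ≤ singularVectorBound ε σ j)

/-- The property `good` holds with probability exceeding `p`: it holds on a measurable event of
probability more than `p`. -/
def HoldsWithProbExceeding {Ω : Type*} [MeasurableSpace Ω] (P : Measure Ω) (p : ℝ)
    (good : Ω → Prop) : Prop :=
  ∃ E : Set Ω, MeasurableSet E ∧ p < P.real E ∧ ∀ ω ∈ E, good ω

end

/-! Write `Y = A diag(σ) Vᵀ` with `A = Φ U`. Everything follows deterministically once `A` is a near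
isometry, that is, `AᵀA` is within `ε` of the identity on `ℝ ^ k`
(`IsNearIsometry.sketchPreserves`). Singular values: the quadratic forms of `YᵀY` and `XᵀX` agree up
to factors `1 ± ε`, so Courant–Fischer transfers these factors to the squared singular values
(`sq_le_mul_sq_of_forall_le`). Singular vectors: put `a = Vᵀ v'_j`, `y = diag(σ) a`, `z = AᵀA y -
y`. The eigenvector equation for `YᵀY` reads `(σ'_j² - σ_i²) a_i = σ_i z_i` in coordinates, and `‖z‖
≤ ε ‖y‖`. A spectral gap thus makes every `a_i` with `i ≠ j` small, which forces `v'_j` close to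
`v_j`. Probability: the JL property and a union bound over a `1/4`-net of at most `25 ^ k` points
make `A` a near isometry (`DistributionalJL.exists_event`). Case (a) reduces to case (b), because
i.i.d. subgaussian entries give the JL property with rate `a η²`, by a Chernoff bound for sums of
squares (`IsScaledSubgaussian.distributionalJL`). -/

/-! ### Dot products, orthonormal columns and near isometries. -/

lemma l2norm_sq {d : ℕ} (x : Fin d → ℝ) : l2norm x ^ 2 = x ⬝ᵥ x := by
  rw [l2norm, EuclideanSpace.norm_sq_eq]
  simp [dotProduct, sq]

lemma dotProduct_self_nonneg_real {ι : Type*} [Fintype ι] (x : ι → ℝ) : 0 ≤ x ⬝ᵥ x :=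
  Finset.sum_nonneg fun i _ => mul_self_nonneg (x i)

lemma dotProduct_mulVec_eq {a b : Type*} [Fintype a] [Fintype b]
    (A : Matrix a b ℝ) (x : a → ℝ) (y : b → ℝ) : x ⬝ᵥ (A *ᵥ y) = (Aᵀ *ᵥ x) ⬝ᵥ y := by
  rw [Matrix.dotProduct_mulVec, Matrix.mulVec_transpose]

lemma dotProduct_mulVec_of_orthonormal {a b : Type*} [Fintype a] [Fintype b] [DecidableEq b]
    {U : Matrix a b ℝ} (hU : Uᵀ * U = 1) (x y : b → ℝ) : (U *ᵥ x) ⬝ᵥ (U *ᵥ y) = x ⬝ᵥ y := by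
  rw [dotProduct_mulVec_eq, Matrix.mulVec_mulVec, hU, Matrix.one_mulVec]

/-- Bessel's inequality for a matrix with orthonormal columns. -/
lemma dotProduct_transpose_mulVec_le {a b : Type*} [Fintype a] [Fintype b] [DecidableEq b]
    {V : Matrix a b ℝ} (hV : Vᵀ * V = 1) (w : a → ℝ) :
    (Vᵀ *ᵥ w) ⬝ᵥ (Vᵀ *ᵥ w) ≤ w ⬝ᵥ w := by
  have h := dotProduct_self_nonneg_real (w - V *ᵥ (Vᵀ *ᵥ w))
  have h1 := dotProduct_mulVec_of_orthonormal hV (Vᵀ *ᵥ w) (Vᵀ *ᵥ w)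
  have h2 : w ⬝ᵥ (V *ᵥ (Vᵀ *ᵥ w)) = (Vᵀ *ᵥ w) ⬝ᵥ (Vᵀ *ᵥ w) := dotProduct_mulVec_eq _ _ _
  rw [sub_dotProduct, dotProduct_sub, dotProduct_sub, h1, h2,
    dotProduct_comm (V *ᵥ (Vᵀ *ᵥ w)) w, h2] at h
  linarith

/-- `A` preserves squared Euclidean norms up to a relative error `ε`. -/
def IsNearIsometry {m k : ℕ} (ε : ℝ) (A : Matrix (Fin m) (Fin k) ℝ) : Prop :=
  ∀ x : Fin k → ℝ, |(A *ᵥ x) ⬝ᵥ (A *ᵥ x) - x ⬝ᵥ x| ≤ ε * (x ⬝ᵥ x)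

/-- Polarization: a near isometry nearly preserves inner products. -/
lemma IsNearIsometry.abs_dotProduct_sub_le {m k : ℕ} {ε : ℝ} {A : Matrix (Fin m) (Fin k) ℝ}
    (hA : IsNearIsometry ε A) (x y : Fin k → ℝ) {t : ℝ} (ht : 0 < t) :
    2 * t * |(A *ᵥ x) ⬝ᵥ (A *ᵥ y) - x ⬝ᵥ y| ≤ ε * (x ⬝ᵥ x + t ^ 2 * (y ⬝ᵥ y)) := by
  have h1 := abs_le.1 (hA (x + t • y))
  have h2 := abs_le.1 (hA (x - t • y))
  simp only [Matrix.mulVec_add, Matrix.mulVec_sub, Matrix.mulVec_smul, add_dotProduct,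
    dotProduct_add, sub_dotProduct, dotProduct_sub, smul_dotProduct, dotProduct_smul,
    smul_eq_mul] at h1 h2
  rw [dotProduct_comm y x, dotProduct_comm (A *ᵥ y) (A *ᵥ x)] at h1 h2
  rw [← abs_of_pos (show 0 < 2 * t by positivity), ← abs_mul, abs_le]
  constructor <;> nlinarith

/-- Bounds the operator norm of `AᵀA - 1` by `ε` without spectral theory: for `z = AᵀA y - y` the
polarized defect of `z` and `y` is `z ⬝ᵥ z` itself, and polarization with `t = ε` lets half of the
left side absorb the `z` term. -/
lemma IsNearIsometry.gram_sub_le {m k : ℕ} {ε : ℝ} {A : Matrix (Fin m) (Fin k) ℝ}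
    (hA : IsNearIsometry ε A) (hε : 0 < ε) (y : Fin k → ℝ) :
    (Aᵀ *ᵥ (A *ᵥ y) - y) ⬝ᵥ (Aᵀ *ᵥ (A *ᵥ y) - y) ≤ ε ^ 2 * (y ⬝ᵥ y) := by
  set z := Aᵀ *ᵥ (A *ᵥ y) - y with hz
  have h := hA.abs_dotProduct_sub_le z y hε
  have h1 : (A *ᵥ z) ⬝ᵥ (A *ᵥ y) - z ⬝ᵥ y = z ⬝ᵥ z := by
    rw [dotProduct_comm (A *ᵥ z), dotProduct_mulVec_eq, dotProduct_comm z y, ← sub_dotProduct]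
  rw [h1, abs_of_nonneg (dotProduct_self_nonneg_real z)] at h
  have : ε * (z ⬝ᵥ z) ≤ ε * (ε ^ 2 * (y ⬝ᵥ y)) := by linarith
  exact le_of_mul_le_mul_left this hε

lemma diagonal_mulVec_dotProduct_self {k : ℕ} (σ a : Fin k → ℝ) :
    (Matrix.diagonal σ *ᵥ a) ⬝ᵥ (Matrix.diagonal σ *ᵥ a) = ∑ i, σ i ^ 2 * a i ^ 2 := by
  simp only [dotProduct, Matrix.mulVec_diagonal]
  exact Finset.sum_congr rfl fun i _ => by ring

/-! ### Courant–Fischer comparison and basic facts on truncated SVDs. -/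

/-- Singular values are monotone in the quadratic form. -/
lemma sq_le_mul_sq_of_forall_le {n k : ℕ} {σ σ' : Fin k → ℝ} {V V' : Matrix (Fin n) (Fin k) ℝ}
    (hV : Vᵀ * V = 1) (hV' : V'ᵀ * V' = 1) (hσ : Antitone σ) (hσ' : Antitone σ')
    (h0 : ∀ j, 0 ≤ σ j) (h0' : ∀ j, 0 ≤ σ' j) {t : ℝ} (ht : 0 ≤ t)
    (h : ∀ w, (Matrix.diagonal σ *ᵥ (Vᵀ *ᵥ w)) ⬝ᵥ (Matrix.diagonal σ *ᵥ (Vᵀ *ᵥ w)) ≤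
      t * ((Matrix.diagonal σ' *ᵥ (V'ᵀ *ᵥ w)) ⬝ᵥ (Matrix.diagonal σ' *ᵥ (V'ᵀ *ᵥ w)))) (j : Fin k) :
    σ j ^ 2 ≤ t * σ' j ^ 2 := by
  -- Courant–Fischer by dimension count: with indices from `0`, vectors supported on `i ≤ j` have `j
  -- + 1` free coordinates and the conditions for `i < j` number only `j`. On `w = V b` the `σ` form
  -- is at least `σ j ^ 2 * (b ⬝ᵥ b)` and the `σ'` form at most `σ' j ^ 2 * (b ⬝ᵥ b)`, by Bessel.
  obtain ⟨b, hb0, hbj, hbV⟩ : ∃ b : Fin k → ℝ, b ≠ 0 ∧ (∀ i, j < i → b i = 0) ∧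
      ∀ i, i < j → (V'ᵀ *ᵥ (V *ᵥ b)) i = 0 := by
    let E : ({i : Fin k // i ≤ j} → ℝ) →ₗ[ℝ] (Fin k → ℝ) :=
      Function.ExtendByZero.linearMap ℝ Subtype.val
    let R : (Fin k → ℝ) →ₗ[ℝ] ({i : Fin k // i < j} → ℝ) := LinearMap.funLeft ℝ ℝ Subtype.val
    let T := R ∘ₗ (V'ᵀ * V).mulVecLin ∘ₗ E
    have hker : LinearMap.ker T ≠ ⊥ := by
      apply LinearMap.ker_ne_bot_of_finrank_lt
      rw [Module.finrank_fintype_fun_eq_card, Module.finrank_fintype_fun_eq_card,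
        Fintype.card_subtype, Fintype.card_subtype]
      exact Finset.card_lt_card (Finset.ssubset_iff_of_subset
        (fun i hi => by simp at hi ⊢; exact hi.le) |>.2 ⟨j, by simp, by simp⟩)
    obtain ⟨c, hc, hc0⟩ := (Submodule.ne_bot_iff _).1 hker
    have hE : ∀ i : {i : Fin k // i ≤ j}, E c i = c i := fun i =>
      Subtype.val_injective.extend_apply _ _ _
    refine ⟨E c, fun h0 => hc0 ?_, fun i hi => ?_, fun i hi => ?_⟩
    · ext i
      rw [← hE, h0]; rfl
    · exact Function.extend_apply' _ _ _ (by rintro ⟨a, rfl⟩; exact absurd a.2 (not_le.2 hi))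
    · have := congrFun (LinearMap.mem_ker.1 hc) ⟨i, hi⟩
      rw [Matrix.mulVec_mulVec]
      exact this
  have hVb : Vᵀ *ᵥ (V *ᵥ b) = b := by rw [Matrix.mulVec_mulVec, hV, Matrix.one_mulVec]
  have hw := h (V *ᵥ b)
  have hB := dotProduct_transpose_mulVec_le hV' (V *ᵥ b)
  rw [dotProduct_mulVec_of_orthonormal hV] at hB
  rw [hVb] at hw
  set a := V'ᵀ *ᵥ (V *ᵥ b)
  rw [diagonal_mulVec_dotProduct_self, diagonal_mulVec_dotProduct_self] at hw
  have h1 : σ j ^ 2 * (b ⬝ᵥ b) ≤ ∑ i, σ i ^ 2 * b i ^ 2 := by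
    rw [dotProduct, Finset.mul_sum]
    refine Finset.sum_le_sum fun i _ => ?_
    rcases le_or_gt i j with hij | hij
    · rw [← sq]
      gcongr
      · exact h0 j
      · exact hσ hij
    · simp [hbj i hij]
  have h2 : ∑ i, σ' i ^ 2 * a i ^ 2 ≤ σ' j ^ 2 * (a ⬝ᵥ a) := by
    rw [dotProduct, Finset.mul_sum]
    refine Finset.sum_le_sum fun i _ => ?_
    rcases lt_or_ge i j with hij | hij
    · simp [hbV i hij]
    · rw [← sq]
      gcongr
      · exact h0' i
      · exact hσ' hij
  have hpos : 0 < b ⬝ᵥ b := lt_of_le_of_ne (dotProduct_self_nonneg_real b)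
    fun h => hb0 (dotProduct_self_eq_zero.1 h.symm)
  have h3 : σ j ^ 2 * (b ⬝ᵥ b) ≤ (t * σ' j ^ 2) * (b ⬝ᵥ b) := by
    calc _ ≤ _ := h1.trans hw
      _ ≤ t * (σ' j ^ 2 * (b ⬝ᵥ b)) := by gcongr; exact h2.trans (by gcongr)
      _ = _ := by ring
  exact le_of_mul_le_mul_right h3 hpos

lemma IsTruncatedSVD.mulVec_dotProduct_self {a n k : ℕ} {A : Matrix (Fin a) (Fin n) ℝ}
    {U : Matrix (Fin a) (Fin k) ℝ} {σ : Fin k → ℝ} {V : Matrix (Fin n) (Fin k) ℝ}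
    (h : IsTruncatedSVD A U σ V) (w : Fin n → ℝ) : (A *ᵥ w) ⬝ᵥ (A *ᵥ w) =
      (Matrix.diagonal σ *ᵥ (Vᵀ *ᵥ w)) ⬝ᵥ (Matrix.diagonal σ *ᵥ (Vᵀ *ᵥ w)) := by
  rw [h.eq_mul, ← Matrix.mulVec_mulVec, ← Matrix.mulVec_mulVec,
    dotProduct_mulVec_of_orthonormal h.left_orthonormal]

lemma IsTruncatedSVD.pos_of_rank_eq {a n k : ℕ} {A : Matrix (Fin a) (Fin n) ℝ}
    {U : Matrix (Fin a) (Fin k) ℝ} {σ : Fin k → ℝ} {V : Matrix (Fin n) (Fin k) ℝ}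
    (h : IsTruncatedSVD A U σ V) (hr : A.rank = k) (j : Fin k) : 0 < σ j := by
  refine lt_of_le_of_ne (h.nonneg j) fun h0 => ?_
  have h1 : k ≤ (Matrix.diagonal σ).rank := by
    refine hr.ge.trans ?_
    rw [h.eq_mul]
    exact (Matrix.rank_mul_le_left _ _).trans (Matrix.rank_mul_le_right _ _)
  rw [Matrix.rank_diagonal] at h1
  have h2 : Fintype.card {i // σ i ≠ 0} < Fintype.card (Fin k) :=
    Fintype.card_subtype_lt (x := j) (by simp [← h0])
  rw [Fintype.card_fin] at h2
  exact absurd h1 (not_le.2 (by convert h2))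

lemma IsTruncatedSVD.gram_mulVec_col {a n k : ℕ} {A : Matrix (Fin a) (Fin n) ℝ}
    {U : Matrix (Fin a) (Fin k) ℝ} {σ : Fin k → ℝ} {V : Matrix (Fin n) (Fin k) ℝ}
    (h : IsTruncatedSVD A U σ V) (j : Fin k) :
    Aᵀ *ᵥ (A *ᵥ V.col j) = σ j ^ 2 • V.col j := by
  have h1 : Aᵀ * A * V = V * Matrix.diagonal (fun i => σ i ^ 2) := by
    rw [h.eq_mul]
    simp only [Matrix.transpose_mul, Matrix.transpose_transpose, Matrix.diagonal_transpose]
    calc _ = V * Matrix.diagonal σ * (Uᵀ * U) * Matrix.diagonal σ * (Vᵀ * V) := by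
          simp only [Matrix.mul_assoc]
      _ = _ := by
          rw [h.left_orthonormal, h.right_orthonormal, Matrix.mul_one, Matrix.mul_one,
            Matrix.mul_assoc, Matrix.diagonal_mul_diagonal]
          simp only [sq]
  have h2 := congrArg (fun M : Matrix (Fin n) (Fin k) ℝ => M.col j) h1
  ext i
  have h3 := congrFun h2 i
  simp only [Matrix.col_apply, Matrix.mul_diagonal] at h3
  rw [Matrix.mulVec_mulVec, Pi.smul_apply, smul_eq_mul, Matrix.col_apply, mul_comm, ← h3]
  rfl

lemma col_dotProduct_col_self {n k : ℕ} {V : Matrix (Fin n) (Fin k) ℝ} (hV : Vᵀ * V = 1)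
    (j : Fin k) : V.col j ⬝ᵥ V.col j = 1 := by
  have := congrFun (congrFun hV j) j
  rwa [Matrix.one_apply_eq] at this

lemma exists_mem_Icc_mul_eq {ε s lam : ℝ} (hε : 0 < ε) (hs : 0 < s) (h1 : (1 - ε) * s ≤ lam)
    (h2 : lam ≤ (1 + ε) * s) : ∃ c ∈ Icc (-1 : ℝ) 1, s * (1 + c * ε) = lam := by
  refine ⟨(lam - s) / (s * ε), ⟨?_, ?_⟩, by field_simp; ring⟩
  · rw [le_div_iff₀ (by positivity)]; linarith
  · rw [div_le_iff₀ (by positivity)]; linarith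

/-- A gap bound extracted from the supremum in `singularVectorBound`. -/
lemma mul_le_toReal_mul_gap {M : ℝ≥0∞} (hM : M ≠ ⊤) {p g : ℝ} {S : Set ℝ} {h : ℝ → ℝ} (hp : 0 < p)
    (hS : ∃ c ∈ S, h c = g) (hle : ENNReal.ofReal p / (⨅ c ∈ S, ENNReal.ofReal |h c|) ≤ M) :
    p ≤ M.toReal * |g| := by
  obtain ⟨c, hc, rfl⟩ := hS
  have h1 : (⨅ c ∈ S, ENNReal.ofReal |h c|) ≤ ENNReal.ofReal |h c| := biInf_le _ hc
  have h2 : ENNReal.ofReal p / ENNReal.ofReal |h c| ≤ M :=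
    (ENNReal.div_le_div_left h1 _).trans hle
  -- A zero gap is excluded by `M ≠ ⊤`, since `p > 0` would make the quotient infinite.
  have h3 : ENNReal.ofReal p ≤ M * ENNReal.ofReal |h c| := by
    rwa [ENNReal.div_le_iff_le_mul (Or.inr hM) (Or.inl ENNReal.ofReal_ne_top)] at h2
  have h4 := ENNReal.toReal_mono (ENNReal.mul_ne_top hM ENNReal.ofReal_ne_top) h3
  rwa [ENNReal.toReal_ofReal hp.le, ENNReal.toReal_mul, ENNReal.toReal_ofReal (abs_nonneg _)] at h4

lemma col_sub_col_dotProduct {n k : ℕ} {V V' : Matrix (Fin n) (Fin k) ℝ} (hV : Vᵀ * V = 1)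
    (hV' : V'ᵀ * V' = 1) (j : Fin k) :
    (V.col j - V'.col j) ⬝ᵥ (V.col j - V'.col j) = 2 - 2 * (V.col j ⬝ᵥ V'.col j) := by
  rw [sub_dotProduct, dotProduct_sub, dotProduct_sub, col_dotProduct_col_self hV,
    col_dotProduct_col_self hV', dotProduct_comm (V'.col j)]
  ring

/-! ### Deterministic perturbation bounds for a sketch by a near isometry. -/

section NearIsometry

variable {m n k : ℕ} {ε : ℝ} {A : Matrix (Fin m) (Fin k) ℝ} {σ σ' : Fin k → ℝ}
  {V V' : Matrix (Fin n) (Fin k) ℝ} {U' : Matrix (Fin m) (Fin k) ℝ}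

/-- Singular values of `A diag(σ) Vᵀ` for a near isometry `A`. -/
lemma IsNearIsometry.sq_singularValue_bounds (hA : IsNearIsometry ε A) (hε : 0 < ε) (hε1 : ε < 1)
    (hV : Vᵀ * V = 1) (hσ : Antitone σ) (h0 : ∀ j, 0 < σ j)
    (hY : IsTruncatedSVD (A * (Matrix.diagonal σ * Vᵀ)) U' σ' V') (j : Fin k) :
    (1 - ε) * σ j ^ 2 ≤ σ' j ^ 2 ∧ σ' j ^ 2 ≤ (1 + ε) * σ j ^ 2 := by
  have key : ∀ w, |(Matrix.diagonal σ' *ᵥ (V'ᵀ *ᵥ w)) ⬝ᵥ (Matrix.diagonal σ' *ᵥ (V'ᵀ *ᵥ w)) -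
      (Matrix.diagonal σ *ᵥ (Vᵀ *ᵥ w)) ⬝ᵥ (Matrix.diagonal σ *ᵥ (Vᵀ *ᵥ w))| ≤
      ε * ((Matrix.diagonal σ *ᵥ (Vᵀ *ᵥ w)) ⬝ᵥ (Matrix.diagonal σ *ᵥ (Vᵀ *ᵥ w))) := by
    intro w
    rw [← hY.mulVec_dotProduct_self, ← Matrix.mulVec_mulVec, ← Matrix.mulVec_mulVec]
    exact hA _
  have h1ε : 0 < 1 - ε := by linarith
  constructor
  · have := sq_le_mul_sq_of_forall_le hV hY.right_orthonormal hσ hY.antitone (fun j => (h0 j).le)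
      hY.nonneg (inv_nonneg.2 h1ε.le) (fun w => ?_) j
    · rwa [inv_mul_eq_div, le_div_iff₀ h1ε, mul_comm] at this
    · rw [inv_mul_eq_div, le_div_iff₀ h1ε]
      linarith [(abs_le.1 (key w)).1]
  · refine sq_le_mul_sq_of_forall_le hY.right_orthonormal hV hY.antitone hσ hY.nonneg
      (fun j => (h0 j).le) (by linarith) (fun w => ?_) j
    linarith [(abs_le.1 (key w)).2]

/-- Right multiplication by `V` recovers `A diag(σ)`, which is injective: for `ε < 1` a near
isometry kills no nonzero vector. -/
lemma IsNearIsometry.rank_mul (hA : IsNearIsometry ε A) (hε1 : ε < 1)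
    (hV : Vᵀ * V = 1) (h0 : ∀ j, 0 < σ j) : (A * (Matrix.diagonal σ * Vᵀ)).rank = k := by
  apply le_antisymm
  · exact (Matrix.rank_mul_le_left _ _).trans (Matrix.rank_le_width _)
  · have h1 : (A * Matrix.diagonal σ).rank ≤ (A * (Matrix.diagonal σ * Vᵀ)).rank := by
      have : A * Matrix.diagonal σ = A * (Matrix.diagonal σ * Vᵀ) * V := by
        rw [Matrix.mul_assoc, Matrix.mul_assoc, hV, Matrix.mul_one]
      rw [this]
      exact Matrix.rank_mul_le_left _ _
    refine le_trans (le_of_eq ?_) h1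
    rw [Matrix.rank, LinearMap.finrank_range_of_inj, Module.finrank_fin_fun]
    rw [← LinearMap.ker_eq_bot, LinearMap.ker_eq_bot']
    intro x hx
    rw [Matrix.mulVecLin_apply, ← Matrix.mulVec_mulVec] at hx
    have h2 := hA (Matrix.diagonal σ *ᵥ x)
    rw [hx, zero_dotProduct, zero_sub, abs_neg,
      abs_of_nonneg (dotProduct_self_nonneg_real _)] at h2
    have h3 : Matrix.diagonal σ *ᵥ x = 0 := dotProduct_self_eq_zero.1
      (le_antisymm (by nlinarith) (dotProduct_self_nonneg_real _))
    ext i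
    have h4 := congrFun h3 i
    rw [Matrix.mulVec_diagonal] at h4
    exact (mul_eq_zero.1 h4).resolve_left (h0 i).ne'

/-- If `√2 σ_i σ_j ≤ r |σ_i² - σ'_j²|` for all `i ≠ j` then the `j`-th right singular vectors of
`diag(σ) Vᵀ` and of its sketch by a near isometry are close. -/
lemma IsNearIsometry.dotProduct_sub_col_le (hA : IsNearIsometry ε A) (hε : 0 < ε) (hε1 : ε < 1)
    (hV : Vᵀ * V = 1) (hσ : Antitone σ) (h0 : ∀ j, 0 < σ j)
    (hY : IsTruncatedSVD (A * (Matrix.diagonal σ * Vᵀ)) U' σ' V') (j : Fin k)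
    (hj : 0 ≤ V.col j ⬝ᵥ V'.col j) {r : ℝ}
    (hgap : ∀ i, i ≠ j → √2 * σ i * σ j ≤ r * |σ i ^ 2 - σ' j ^ 2|) :
    (V.col j - V'.col j) ⬝ᵥ (V.col j - V'.col j) ≤ (ε * √(1 + ε) / √(1 - ε) * r) ^ 2 := by
  obtain ⟨hl, hu⟩ := hA.sq_singularValue_bounds hε hε1 hV hσ h0 hY j
  have h1ε : 0 < 1 - ε := by linarith
  set v := V'.col j with hv
  set a := Vᵀ *ᵥ v with ha
  set y := Matrix.diagonal σ *ᵥ a with hy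
  set z := Aᵀ *ᵥ (A *ᵥ y) - y with hz
  have hlam : 0 < σ' j ^ 2 := lt_of_lt_of_le (mul_pos h1ε (pow_pos (h0 j) 2)) hl
  have heig := hY.gram_mulVec_col j
  have hYv : (A * (Matrix.diagonal σ * Vᵀ)) *ᵥ v = A *ᵥ y := by
    rw [← Matrix.mulVec_mulVec, ← Matrix.mulVec_mulVec]
  have hyy : (A *ᵥ y) ⬝ᵥ (A *ᵥ y) = σ' j ^ 2 := by
    rw [← hYv, dotProduct_mulVec_eq, heig, smul_dotProduct,
      col_dotProduct_col_self hY.right_orthonormal, smul_eq_mul, mul_one]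
  rw [← hv, hYv, Matrix.transpose_mul, Matrix.transpose_mul, Matrix.transpose_transpose,
    Matrix.diagonal_transpose, ← Matrix.mulVec_mulVec, ← Matrix.mulVec_mulVec] at heig
  -- Coordinates, in the basis `V`, of the eigenvector equation `YᵀY v = σ'_j² v`.
  have hcoord : ∀ i, σ i * (z i + y i) = σ' j ^ 2 * a i := by
    intro i
    have h := congrFun (congrArg (fun u => Vᵀ *ᵥ u) heig) i
    simp only [Matrix.mulVec_smul] at h
    rw [Matrix.mulVec_mulVec, hV, Matrix.one_mulVec, Matrix.mulVec_diagonal] at h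
    rw [← ha, Pi.smul_apply, smul_eq_mul] at h
    rw [← h, hz, Pi.sub_apply]
    ring
  have haa : a ⬝ᵥ a = 1 := by
    -- Since `σ'_j ≠ 0`, the eigenvector `v` lies in the column space of `V`, so passing to `a`
    -- loses no norm.
    have hva : V *ᵥ a = v := by
      have h : V *ᵥ (Vᵀ *ᵥ (σ' j ^ 2 • v)) = σ' j ^ 2 • v := by
        rw [← heig]
        nth_rw 2 [Matrix.mulVec_mulVec]
        rw [hV, Matrix.one_mulVec]
      rw [Matrix.mulVec_smul, Matrix.mulVec_smul] at h
      exact smul_right_injective _ hlam.ne' h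
    rw [← dotProduct_mulVec_of_orthonormal hV, hva, hv,
      col_dotProduct_col_self hY.right_orthonormal]
  have haj : a j = V.col j ⬝ᵥ v := rfl
  have hzz : z ⬝ᵥ z ≤ ε ^ 2 * (y ⬝ᵥ y) := hA.gram_sub_le hε y
  have hyb : (1 - ε) * (y ⬝ᵥ y) ≤ (1 + ε) * σ j ^ 2 := by
    have := (abs_le.1 (hA y)).1
    rw [hyy] at this
    linarith
  have hi : ∀ i, i ≠ j → 2 * σ j ^ 2 * a i ^ 2 ≤ r ^ 2 * z i ^ 2 := by
    intro i hij
    have hyi : y i = σ i * a i := by rw [hy, Matrix.mulVec_diagonal]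
    have h1 : (σ' j ^ 2 - σ i ^ 2) * a i = σ i * z i := by
      have := hcoord i
      rw [hyi] at this
      linarith
    have h2 : (√2 * σ i * σ j) ^ 2 ≤ (r * |σ i ^ 2 - σ' j ^ 2|) ^ 2 := by
      have := (h0 i).le
      have := (h0 j).le
      exact pow_le_pow_left₀ (by positivity) (hgap i hij) 2
    rw [mul_pow, mul_pow, mul_pow, sq_abs, Real.sq_sqrt (by norm_num)] at h2
    have h3 := mul_le_mul_of_nonneg_right h2 (sq_nonneg (a i))
    have h4 : σ i ^ 2 * (2 * σ j ^ 2 * a i ^ 2) ≤ σ i ^ 2 * (r ^ 2 * z i ^ 2) := by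
      calc _ = 2 * σ i ^ 2 * σ j ^ 2 * a i ^ 2 := by ring
        _ ≤ _ := h3
        _ = r ^ 2 * ((σ' j ^ 2 - σ i ^ 2) * a i) ^ 2 := by ring
        _ = _ := by rw [h1]; ring
    exact le_of_mul_le_mul_left h4 (pow_pos (h0 i) 2)
  have hsum : 2 * σ j ^ 2 * (1 - a j ^ 2) ≤ r ^ 2 * (z ⬝ᵥ z) := by
    have h1 : 1 - a j ^ 2 = ∑ i ∈ Finset.univ.erase j, a i ^ 2 := by
      rw [← haa, dotProduct, ← Finset.add_sum_erase _ _ (Finset.mem_univ j)]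
      simp only [sq]
      ring
    have h2 : ∑ i ∈ Finset.univ.erase j, z i ^ 2 ≤ z ⬝ᵥ z := by
      simp only [dotProduct, ← sq]
      exact Finset.sum_le_sum_of_subset_of_nonneg (Finset.subset_univ _)
        fun i _ _ => sq_nonneg _
    rw [h1, Finset.mul_sum]
    refine (Finset.sum_le_sum fun i hi' => hi i (Finset.ne_of_mem_erase hi')).trans ?_
    rw [← Finset.mul_sum]
    gcongr
  have haj1 : a j ≤ 1 := by
    have : a j * a j ≤ a ⬝ᵥ a :=
      Finset.single_le_sum (f := fun i => a i * a i) (fun i _ => mul_self_nonneg _)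
        (Finset.mem_univ j)
    nlinarith
  rw [← haj] at hj
  rw [col_sub_col_dotProduct hV hY.right_orthonormal, ← hv, ← haj, mul_pow, div_pow, mul_pow,
    Real.sq_sqrt (by linarith), Real.sq_sqrt h1ε.le]
  have h5 : σ j ^ 2 * (2 * (1 - a j ^ 2)) ≤ σ j ^ 2 * (ε ^ 2 * (1 + ε) / (1 - ε) * r ^ 2) := by
    have h6 : y ⬝ᵥ y ≤ (1 + ε) * σ j ^ 2 / (1 - ε) := by
      rw [le_div_iff₀ h1ε]; linarith
    calc _ = 2 * σ j ^ 2 * (1 - a j ^ 2) := by ring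
      _ ≤ r ^ 2 * (ε ^ 2 * ((1 + ε) * σ j ^ 2 / (1 - ε))) :=
        hsum.trans (by gcongr; exact hzz.trans (by gcongr))
      _ = _ := by ring
  have h6 := le_of_mul_le_mul_left h5 (pow_pos (h0 j) 2)
  -- As `0 ≤ a j ≤ 1`, the squared distance `2 (1 - a j)` is at most `2 (1 - a j ^ 2)`.
  nlinarith

/-- Sketching by a near isometry preserves the SVD. -/
theorem IsNearIsometry.sketchPreserves (hA : IsNearIsometry ε A) (hε : 0 < ε) (hε1 : ε < 1)
    (hV : Vᵀ * V = 1) (hσ : Antitone σ) (h0 : ∀ j, 0 < σ j) :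
    SketchPreserves ε σ V (A * (Matrix.diagonal σ * Vᵀ)) := by
  refine ⟨hA.rank_mul hε1 hV h0, fun U' σ' V' hY => ⟨fun j => ?_, fun j hj => ?_⟩⟩
  · obtain ⟨hl, hu⟩ := hA.sq_singularValue_bounds hε hε1 hV hσ h0 hY j
    have hs := pow_pos (h0 j) 2
    have hq : 0 ≤ σ' j / σ j := div_nonneg (hY.nonneg j) (h0 j).le
    constructor
    · rw [Real.sqrt_le_left hq, div_pow, le_div_iff₀ hs]
      exact hl
    · refine Real.le_sqrt_of_sq_le ?_
      rw [div_pow, div_le_iff₀ hs]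
      exact hu
  · obtain ⟨hl, hu⟩ := hA.sq_singularValue_bounds hε hε1 hV hσ h0 hY j
    have h1ε : 0 < 1 - ε := by linarith
    refine le_min (ENNReal.ofReal_le_ofReal ?_) ?_
    · refine Real.le_sqrt_of_sq_le ?_
      rw [l2norm_sq, col_sub_col_dotProduct hV hY.right_orthonormal]
      linarith
    set M := ⨆ (i : Fin k) (_ : i ≠ j), ENNReal.ofReal (√2 * σ i * σ j) /
        ⨅ c ∈ Icc (-1 : ℝ) 1, ENNReal.ofReal |σ i ^ 2 - σ j ^ 2 * (1 + c * ε)| with hMdef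
    have hκ : 0 < ε * √(1 + ε) / √(1 - ε) := by positivity
    by_cases hM : M = ⊤
    · rw [hM, ENNReal.mul_top (by simpa using hκ)]
      exact le_top
    rw [← ENNReal.ofReal_toReal hM, ← ENNReal.ofReal_mul hκ.le]
    refine ENNReal.ofReal_le_ofReal (le_of_sq_le_sq ?_ (by positivity))
    rw [l2norm_sq]
    refine hA.dotProduct_sub_col_le hε hε1 hV hσ h0 hY j hj fun i hij => ?_
    -- The perturbed value `σ'_j²` is one of the points `σ_j² (1 + c ε)` in the infimum, so the true
    -- gap dominates that infimum.
    obtain ⟨c, hc, hcl⟩ := exists_mem_Icc_mul_eq hε (pow_pos (h0 j) 2) hl hu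
    have := h0 i
    have := h0 j
    refine mul_le_toReal_mul_gap (S := Icc (-1 : ℝ) 1)
      (h := fun c => σ i ^ 2 - σ j ^ 2 * (1 + c * ε)) hM (by positivity) ⟨c, hc, by simp [hcl]⟩ ?_
    exact le_iSup₂ (f := fun (i : Fin k) (_ : i ≠ j) => ENNReal.ofReal (√2 * σ i * σ j) /
        ⨅ c ∈ Icc (-1 : ℝ) 1, ENNReal.ofReal |σ i ^ 2 - σ j ^ 2 * (1 + c * ε)|) i hij

end NearIsometry

/-! ### Nets of the unit ball and reduction to a net. -/

/-- The unit ball of a `d`-dimensional normed space has a `1/2`-net with at most `5 ^ d` points. -/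
lemma exists_half_net (E : Type*) [NormedAddCommGroup E] [NormedSpace ℝ E]
    [FiniteDimensional ℝ E] : ∃ T : Finset E, T.card ≤ 5 ^ Module.finrank ℝ E ∧
      ∀ x : E, ‖x‖ ≤ 1 → ∃ y ∈ T, ‖x - y‖ ≤ 1 / 2 := by
  classical
  have hsep : ∀ s : Finset E, (s : Set E) ⊆ Metric.closedBall 0 2 →
      Metric.IsSeparated (1 : ℝ≥0) (s : Set E) → s.card ≤ 5 ^ Module.finrank ℝ E := by
    intro s hs hs'
    refine Besicovitch.card_le_of_separated s (fun c hc => by simpa using hs hc) ?_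
    intro c hc d hd hcd
    have h : ((1 : ℝ≥0) : ℝ≥0∞) < edist c d := hs' hc hd hcd
    rw [edist_dist, ENNReal.coe_one, ENNReal.one_lt_ofReal] at h
    rw [← dist_eq_norm]
    exact h.le
  have hpack : Metric.packingNumber 1 (Metric.closedBall (0 : E) 2) ≤
      ((5 ^ Module.finrank ℝ E : ℕ) : ℕ∞) := by
    refine iSup_le fun C => iSup_le fun hC => iSup_le fun hC' => ?_
    by_contra! hlt
    obtain ⟨t, htC, ht⟩ := Set.exists_subset_encard_eq (Order.add_one_le_of_lt hlt)
    have htf : t.Finite := Set.finite_of_encard_eq_coe (k := 5 ^ Module.finrank ℝ E + 1) (by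
      rw [ht]; norm_cast)
    have h := hsep htf.toFinset (by simpa using htC.trans hC)
      (by simpa using hC'.subset htC)
    rw [htf.encard_eq_coe_toFinset_card] at ht
    norm_cast at ht
    omega
  have hne : Metric.packingNumber 1 (Metric.closedBall (0 : E) 2) ≠ ⊤ :=
    (hpack.trans_lt (ENat.natCast_lt_top _)).ne
  have hfin : (Metric.maximalSeparatedSet 1 (Metric.closedBall (0 : E) 2)).Finite := by
    rw [← Set.encard_lt_top_iff, Metric.encard_maximalSeparatedSet hne]
    exact hne.lt_top
  -- A maximal `1`-separated subset of the ball of radius `2` covers it at scale `1`; halving gives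
  -- scale `1/2` on the unit ball.
  refine ⟨hfin.toFinset.image fun x => (1 / 2 : ℝ) • x, ?_, fun x hx => ?_⟩
  · refine Finset.card_image_le.trans (hsep _ ?_ ?_)
    · simpa using Metric.maximalSeparatedSet_subset
    · rw [hfin.coe_toFinset]
      exact Metric.isSeparated_maximalSeparatedSet
  · obtain ⟨y, hy, hxy⟩ := Metric.isCover_maximalSeparatedSet hne
      (show (2 : ℝ) • x ∈ Metric.closedBall (0 : E) 2 by
        rw [mem_closedBall_zero_iff, norm_smul]; norm_num; linarith)
    refine ⟨(1 / 2 : ℝ) • y, Finset.mem_image_of_mem _ (by simpa using hy), ?_⟩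
    have h1 : dist ((2 : ℝ) • x) y ≤ 1 := by
      have h2 : edist ((2 : ℝ) • x) y ≤ (1 : ℝ≥0) := hxy
      rwa [edist_dist, ENNReal.coe_one, ENNReal.ofReal_le_one] at h2
    have h3 : x - (1 / 2 : ℝ) • y = (1 / 2 : ℝ) • ((2 : ℝ) • x - y) := by
      rw [smul_sub, smul_smul]; norm_num
    rw [h3, norm_smul, ← dist_eq_norm]
    norm_num
    linarith

/-- The Euclidean unit ball of `ℝ ^ k` has a `1/4`-net with at most `25 ^ k` points. -/
lemma exists_quarter_net (k : ℕ) : ∃ T : Finset (Fin k → ℝ), T.card ≤ 25 ^ k ∧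
    ∀ x : Fin k → ℝ, x ⬝ᵥ x ≤ 1 → ∃ y ∈ T, (x - y) ⬝ᵥ (x - y) ≤ 1 / 16 := by
  classical
  obtain ⟨T, hT, hnet⟩ := exists_half_net (EuclideanSpace ℝ (Fin k))
  rw [finrank_euclideanSpace_fin] at hT
  refine ⟨(T ×ˢ T).image fun p => WithLp.ofLp (p.1 + (1 / 2 : ℝ) • p.2), ?_, fun x hx => ?_⟩
  · refine Finset.card_image_le.trans ?_
    rw [Finset.card_product, show 25 = 5 * 5 from rfl, mul_pow]
    exact Nat.mul_le_mul hT hT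
  · have hx1 : ‖WithLp.toLp 2 x‖ ≤ 1 := by
      rw [← l2norm_sq] at hx
      exact (sq_le_one_iff₀ (norm_nonneg _)).1 hx
    obtain ⟨a, ha, hxa⟩ := hnet _ hx1
    -- The residual `x - a` has norm at most `1/2`, so its double can be approximated by the same
    -- net; `a + b / 2` is then within `1/4` of `x`.
    obtain ⟨b, hb, hxb⟩ := hnet ((2 : ℝ) • (WithLp.toLp 2 x - a)) (by
      rw [norm_smul]; norm_num; linarith)
    refine ⟨_, Finset.mem_image_of_mem _ (Finset.mk_mem_product ha hb), ?_⟩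
    have h1 : WithLp.toLp 2 (x - WithLp.ofLp (a + (1 / 2 : ℝ) • b)) =
        (1 / 2 : ℝ) • ((2 : ℝ) • (WithLp.toLp 2 x - a) - b) := by
      rw [smul_sub, smul_smul]
      ext i
      simp
      ring
    rw [← l2norm_sq, l2norm, h1, norm_smul]
    norm_num
    nlinarith [norm_nonneg ((2 : ℝ) • (WithLp.toLp 2 x - a) - b)]

/-- The best near-isometry constant is attained in the unit ball, by compactness and homogeneity.
Attainment permits the bootstrap from a net, in which the constant is bounded in terms of itself. -/
lemma exists_isMaxOn_isNearIsometry {m k : ℕ} (A : Matrix (Fin m) (Fin k) ℝ) :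
    ∃ x : Fin k → ℝ, x ⬝ᵥ x ≤ 1 ∧ IsNearIsometry |(A *ᵥ x) ⬝ᵥ (A *ᵥ x) - x ⬝ᵥ x| A := by
  have hcont : Continuous fun x : Fin k → ℝ => |(A *ᵥ x) ⬝ᵥ (A *ᵥ x) - x ⬝ᵥ x| := by
    fun_prop
  have hcpt : IsCompact {x : Fin k → ℝ | x ⬝ᵥ x ≤ 1} := by
    refine (isCompact_Icc (a := fun _ : Fin k => (-1 : ℝ)) (b := fun _ => 1)).of_isClosed_subset
      (isClosed_le (by fun_prop) continuous_const) fun x hx => ?_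
    have h : ∀ i, -1 ≤ x i ∧ x i ≤ 1 := fun i => by
      rw [← abs_le, ← sq_le_one_iff_abs_le_one, sq]
      exact (Finset.single_le_sum (f := fun i => x i * x i) (fun i _ => mul_self_nonneg _)
        (Finset.mem_univ i)).trans hx
    exact ⟨fun i => (h i).1, fun i => (h i).2⟩
  obtain ⟨x₀, hx₀, hmax⟩ := hcpt.exists_isMaxOn ⟨0, by simp⟩ hcont.continuousOn
  refine ⟨x₀, hx₀, fun x => ?_⟩
  rcases eq_or_ne x 0 with rfl | hx
  · simp
  have hpos : 0 < x ⬝ᵥ x := lt_of_le_of_ne (dotProduct_self_nonneg_real x)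
    fun h => hx (dotProduct_self_eq_zero.1 h.symm)
  have hs : (√(x ⬝ᵥ x))⁻¹ * (√(x ⬝ᵥ x))⁻¹ = (x ⬝ᵥ x)⁻¹ := by
    rw [← mul_inv, Real.mul_self_sqrt hpos.le]
  have h : |((√(x ⬝ᵥ x))⁻¹ * (√(x ⬝ᵥ x))⁻¹) * ((A *ᵥ x) ⬝ᵥ (A *ᵥ x) - x ⬝ᵥ x)| ≤
      |(A *ᵥ x₀) ⬝ᵥ (A *ᵥ x₀) - x₀ ⬝ᵥ x₀| := by
    have := hmax (show (√(x ⬝ᵥ x))⁻¹ • x ∈ {x : Fin k → ℝ | x ⬝ᵥ x ≤ 1} by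
      simp only [Set.mem_ofPred_eq, smul_dotProduct, dotProduct_smul, smul_eq_mul]
      rw [← mul_assoc, hs, inv_mul_cancel₀ hpos.ne'])
    simp only [Set.mem_ofPred_eq, Matrix.mulVec_smul, smul_dotProduct, dotProduct_smul,
      smul_eq_mul] at this
    rwa [← mul_assoc, ← mul_assoc, ← mul_sub] at this
  rw [hs, abs_mul, abs_of_pos (inv_pos.2 hpos), inv_mul_eq_div, div_le_iff₀ hpos] at h
  exact h

/-- A near isometry on a `1/4`-net of the unit ball is a near isometry. -/
lemma isNearIsometry_of_net {m k : ℕ} {A : Matrix (Fin m) (Fin k) ℝ} {T : Set (Fin k → ℝ)}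
    (hT : ∀ x : Fin k → ℝ, x ⬝ᵥ x ≤ 1 → ∃ y ∈ T, (x - y) ⬝ᵥ (x - y) ≤ 1 / 16) {η : ℝ} (hη : 0 ≤ η)
    (h : ∀ y ∈ T, |(A *ᵥ y) ⬝ᵥ (A *ᵥ y) - y ⬝ᵥ y| ≤ η * (y ⬝ᵥ y)) : IsNearIsometry (4 * η) A := by
  obtain ⟨x, hx, hA⟩ := exists_isMaxOn_isNearIsometry A
  set lam := |(A *ᵥ x) ⬝ᵥ (A *ᵥ x) - x ⬝ᵥ x| with hlam
  have hlam0 : 0 ≤ lam := abs_nonneg _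
  obtain ⟨y, hyT, hxy⟩ := hT x hx
  obtain ⟨d, rfl⟩ : ∃ d, y = x - d := ⟨x - y, by simp⟩
  rw [sub_sub_cancel] at hxy
  have h1 := abs_le.1 (h _ hyT)
  have h2 := abs_le.1 (hA d)
  have h3 := hA.abs_dotProduct_sub_le x d (t := 4) (by norm_num)
  have h4 : |(A *ᵥ x) ⬝ᵥ (A *ᵥ d) - x ⬝ᵥ d| ≤ lam / 4 := by
    nlinarith
  have h5 : |x ⬝ᵥ d| ≤ 1 / 4 := by
    have e1 := dotProduct_self_nonneg_real (x - (4 : ℝ) • d)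
    have e2 := dotProduct_self_nonneg_real (x + (4 : ℝ) • d)
    simp only [add_dotProduct, dotProduct_add, sub_dotProduct, dotProduct_sub, smul_dotProduct,
      dotProduct_smul, smul_eq_mul] at e1 e2
    rw [dotProduct_comm d x] at e1 e2
    rw [abs_le]
    constructor <;> linarith
  rw [abs_le] at h4 h5
  have h6 : (x - d) ⬝ᵥ (x - d) ≤ 25 / 16 := by
    rw [sub_dotProduct, dotProduct_sub, dotProduct_sub, dotProduct_comm d x]
    linarith
  have h7 := mul_le_mul_of_nonneg_left h6 hη
  have h8 := mul_le_mul_of_nonneg_left hxy hlam0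
  simp only [Matrix.mulVec_sub, sub_dotProduct, dotProduct_sub] at h1 h7
  rw [dotProduct_comm d x, dotProduct_comm (A *ᵥ d) (A *ᵥ x)] at h1
  rw [dotProduct_comm d x] at h7
  -- Expanding the defect at `x - d` gives `lam ≤ (25/16) η + lam/2 + lam/16`, so `lam ≤ (25/7) η`.
  have h9 : lam ≤ 4 * η := by
    rcases abs_cases ((A *ᵥ x) ⬝ᵥ (A *ᵥ x) - x ⬝ᵥ x) with ⟨e, _⟩ | ⟨e, _⟩ <;>
      rw [← hlam] at e <;> linarith
  exact fun u => (hA u).trans (mul_le_mul_of_nonneg_right h9 (dotProduct_self_nonneg_real u))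

/-! ### Concentration for subgaussian matrices. -/

section Subgaussian

variable {Ω : Type*} [MeasurableSpace Ω] {P : Measure Ω}

lemma lintegral_ofReal_exp_neg_mul_sq {b : ℝ} (hb : 0 < b) (a : ℝ) :
    ∫⁻ t : ℝ, ENNReal.ofReal (Real.exp (-b * (t - a) ^ 2)) = ENNReal.ofReal √(Real.pi / b) := by
  rw [lintegral_sub_right_eq_self (fun t : ℝ => ENNReal.ofReal (Real.exp (-b * t ^ 2))) a,
    ← ofReal_integral_eq_lintegral_ofReal (integrable_exp_neg_mul_sq hb)
      (ae_of_all _ fun _ => (Real.exp_pos _).le), integral_gaussian]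

lemma ProbabilityTheory.HasSubgaussianMGF.mono {Z : Ω → ℝ} {c c' : ℝ≥0}
    (h : HasSubgaussianMGF Z c P) (hc : c ≤ c') : HasSubgaussianMGF Z c' P :=
  ⟨h.integrable_exp_mul, fun t => (h.mgf_le t).trans (Real.exp_le_exp.2 (by gcongr))⟩

variable [IsProbabilityMeasure P]

/-- The bound `exp (c t² / 2)` touches the moment generating function at `t = 0`, so both have the
same derivative there. -/
lemma ProbabilityTheory.HasSubgaussianMGF.integral_eq_zero {Z : Ω → ℝ} {c : ℝ≥0}
    (h : HasSubgaussianMGF Z c P) : ∫ ω, Z ω ∂P = 0 := by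
  have h1 : HasDerivAt (mgf Z P) (∫ ω, Z ω ∂P) 0 := by
    have := hasDerivAt_mgf (X := Z) (μ := P) (t := 0) (by simp [h.integrableExpSet_eq_univ])
    simpa using this
  have h2 : HasDerivAt (fun t : ℝ => Real.exp (c * t ^ 2 / 2)) 0 0 := by
    have := (((hasDerivAt_pow 2 (0 : ℝ)).const_mul (c : ℝ)).div_const 2).exp
    simpa using this
  have hmin : IsLocalMin (fun t => Real.exp (c * t ^ 2 / 2) - mgf Z P t) 0 :=
    Eventually.of_forall fun t => by simpa using h.mgf_le t
  have := hmin.hasDerivAt_eq_zero (h2.sub h1)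
  linarith

lemma ProbabilityTheory.HasSubgaussianMGF.integral_sq {Z : Ω → ℝ} {c : ℝ≥0}
    (h : HasSubgaussianMGF Z c P) : ∫ ω, Z ω ^ 2 ∂P = Var[Z; P] :=
  (variance_of_integral_eq_zero h.aemeasurable h.integral_eq_zero).symm

/-- The square of a subgaussian variable has an exponential moment. -/
lemma ProbabilityTheory.HasSubgaussianMGF.lintegral_exp_sq_le {Z : Ω → ℝ} {c : ℝ≥0}
    (h : HasSubgaussianMGF Z c P) (hZ : Measurable Z) (hc : 0 < c) :
    ∫⁻ ω, ENNReal.ofReal (Real.exp (Z ω ^ 2 / (4 * c))) ∂P ≤ ENNReal.ofReal √2 := by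
  have hc' : (0 : ℝ) < c := hc
  have hpi := Real.pi_pos
  -- Completing the square writes `exp (z² / (4c))` as a Gaussian average of `exp (t z)`; after
  -- Tonelli only the bound on the moment generating function is needed.
  have h1 : ∀ z : ℝ, ENNReal.ofReal √(Real.pi / c) * ENNReal.ofReal (Real.exp (z ^ 2 / (4 * c))) =
      ∫⁻ t : ℝ, ENNReal.ofReal (Real.exp (-c * t ^ 2)) * ENNReal.ofReal (Real.exp (t * z)) := by
    intro z
    rw [← lintegral_ofReal_exp_neg_mul_sq hc' (z / (2 * c)), ← lintegral_mul_const _ (by fun_prop)]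
    refine lintegral_congr fun t => ?_
    rw [← ENNReal.ofReal_mul (Real.exp_pos _).le, ← ENNReal.ofReal_mul (Real.exp_pos _).le,
      ← Real.exp_add, ← Real.exp_add]
    congr 2
    field_simp
    ring
  have h2 : ENNReal.ofReal √(Real.pi / c) *
      ∫⁻ ω, ENNReal.ofReal (Real.exp (Z ω ^ 2 / (4 * c))) ∂P ≤
      ENNReal.ofReal √(Real.pi / (c / 2)) := by
    rw [← lintegral_const_mul _ (by fun_prop)]
    simp_rw [h1]
    rw [lintegral_lintegral_swap (by fun_prop), ← lintegral_ofReal_exp_neg_mul_sq (half_pos hc') 0]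
    refine lintegral_mono fun t => ?_
    rw [lintegral_const_mul _ (by fun_prop), ← ofReal_integral_eq_lintegral_ofReal
      (h.integrable_exp_mul t) (ae_of_all _ fun _ => (Real.exp_pos _).le)]
    calc _ ≤ ENNReal.ofReal (Real.exp (-c * t ^ 2)) *
          ENNReal.ofReal (Real.exp (c * t ^ 2 / 2)) := by
            gcongr
            exact h.mgf_le t
      _ = _ := by
        rw [← ENNReal.ofReal_mul (Real.exp_pos _).le, ← Real.exp_add]
        congr 2
        ring
  have h3 : √(Real.pi / (c / 2)) = √(Real.pi / c) * √2 := by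
    rw [← Real.sqrt_mul (by positivity)]
    congr 1
    field_simp
  rw [h3, ENNReal.ofReal_mul (by positivity)] at h2
  exact (ENNReal.mul_le_mul_iff_right (by simp; positivity) ENNReal.ofReal_ne_top).1 h2

lemma ProbabilityTheory.HasSubgaussianMGF.integrable_exp_sq {Z : Ω → ℝ} {c : ℝ≥0}
    (h : HasSubgaussianMGF Z c P) (hZ : Measurable Z) (hc : 0 < c) :
    Integrable (fun ω => Real.exp (Z ω ^ 2 / (4 * c))) P := by
  refine ⟨by fun_prop, ?_⟩
  rw [hasFiniteIntegral_iff_ofReal (ae_of_all _ fun _ => (Real.exp_pos _).le)]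
  exact (h.lintegral_exp_sq_le hZ hc).trans_lt ENNReal.ofReal_lt_top

lemma ProbabilityTheory.HasSubgaussianMGF.integral_exp_sq_le {Z : Ω → ℝ} {c : ℝ≥0}
    (h : HasSubgaussianMGF Z c P) (hZ : Measurable Z) (hc : 0 < c) :
    ∫ ω, Real.exp (Z ω ^ 2 / (4 * c)) ∂P ≤ 2 := by
  have h1 := h.lintegral_exp_sq_le hZ hc
  rw [← ofReal_integral_eq_lintegral_ofReal (h.integrable_exp_sq hZ hc)
      (ae_of_all _ fun _ => (Real.exp_pos _).le), ENNReal.ofReal_le_ofReal_iff (by positivity)] at h1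
  exact h1.trans (Real.sqrt_le_iff.2 ⟨by norm_num, by norm_num⟩)

lemma Real.exp_le_one_add_add_sq_mul_exp_abs (x : ℝ) :
    Real.exp x ≤ 1 + x + x ^ 2 * Real.exp |x| := by
  rcases le_total 0 x with hx | hx
  · rw [abs_of_nonneg hx]
    have h1 : Real.exp x - 1 ≤ x * Real.exp x := by
      have h2 := mul_le_mul_of_nonneg_right (Real.add_one_le_exp (-x)) (Real.exp_pos x).le
      rw [← Real.exp_add, neg_add_cancel, Real.exp_zero] at h2
      linarith
    nlinarith
  · have h1 : Real.exp x * (1 - x) ≤ 1 := by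
      have h2 := mul_le_mul_of_nonneg_left (Real.add_one_le_exp (-x)) (Real.exp_pos x).le
      rw [← Real.exp_add, add_neg_cancel, Real.exp_zero] at h2
      linarith
    have h3 : Real.exp x ≤ 1 + x + x ^ 2 := by
      by_contra! h4
      -- For `x ≤ 0`, `(1 + x + x²)(1 - x) = 1 - x³ ≥ 1`.
      nlinarith [mul_le_mul_of_nonneg_right h4.le (show 0 ≤ 1 - x by linarith), sq_nonneg x,
        mul_nonneg (sq_nonneg x) (neg_nonneg.2 hx), mul_pos (sub_pos.2 h4)
          (show 0 < 1 - x by linarith)]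
    nlinarith [sq_nonneg x, Real.one_le_exp (abs_nonneg x)]

/-- The second-order remainder is absorbed by `exp (u / (4c))`: one factor `exp (u / (8c))`
dominates `exp |τ u|`, the other dominates `u²` up to `128 c²`. -/
lemma exp_mul_le_of_abs_le {c u τ : ℝ} (hc : 0 < c) (hu : 0 ≤ u) (hτ : |τ| ≤ 1 / (8 * c)) :
    Real.exp (τ * u) ≤ 1 + τ * u + 128 * c ^ 2 * τ ^ 2 * Real.exp (u / (4 * c)) := by
  refine (Real.exp_le_one_add_add_sq_mul_exp_abs _).trans ?_
  have h1 : Real.exp |τ * u| ≤ Real.exp (u / (8 * c)) := by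
    rw [abs_mul, abs_of_nonneg hu]
    refine Real.exp_le_exp.2 ((mul_le_mul_of_nonneg_right hτ hu).trans (le_of_eq (by ring)))
  have h2 : u ^ 2 ≤ 128 * c ^ 2 * Real.exp (u / (8 * c)) := by
    have h3 := Real.quadratic_le_exp_of_nonneg (show 0 ≤ u / (8 * c) by positivity)
    have h4 : (u / (8 * c)) ^ 2 / 2 ≤ Real.exp (u / (8 * c)) := by
      have : 0 ≤ u / (8 * c) := by positivity
      linarith
    calc u ^ 2 = 128 * c ^ 2 * ((u / (8 * c)) ^ 2 / 2) := by field_simp; ring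
      _ ≤ _ := by gcongr
  have h5 : Real.exp (u / (4 * c)) = Real.exp (u / (8 * c)) * Real.exp (u / (8 * c)) := by
    rw [← Real.exp_add]; congr 1; field_simp; ring
  rw [h5, mul_pow]
  have : τ ^ 2 * u ^ 2 * Real.exp |τ * u| ≤
      τ ^ 2 * (128 * c ^ 2 * Real.exp (u / (8 * c))) * Real.exp (u / (8 * c)) := by gcongr
  linarith

/-- The moment generating function of the square of a subgaussian variable near `0`. -/
lemma ProbabilityTheory.HasSubgaussianMGF.integrable_exp_mul_sq {Z : Ω → ℝ} {c : ℝ≥0}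
    (h : HasSubgaussianMGF Z c P) (hZ : Measurable Z) (hc : 0 < c) {τ : ℝ}
    (hτ : |τ| ≤ 1 / (8 * c)) : Integrable (fun ω => Real.exp (τ * Z ω ^ 2)) P := by
  have hc' : (0 : ℝ) < c := hc
  refine (h.integrable_exp_sq hZ hc).mono' (by fun_prop) (ae_of_all _ fun ω => ?_)
  rw [Real.norm_of_nonneg (Real.exp_pos _).le, Real.exp_le_exp]
  calc τ * Z ω ^ 2 ≤ 1 / (4 * c) * Z ω ^ 2 := by
        gcongr
        refine (le_abs_self τ).trans (hτ.trans ?_)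
        gcongr
        norm_num
    _ = _ := by ring

lemma ProbabilityTheory.HasSubgaussianMGF.mgf_sq_le {Z : Ω → ℝ} {c : ℝ≥0}
    (h : HasSubgaussianMGF Z c P) (hZ : Measurable Z) (hc : 0 < c) (hvar : Var[Z; P] = 1) {τ : ℝ}
    (hτ : |τ| ≤ 1 / (8 * c)) :
    mgf (fun ω => Z ω ^ 2) P τ ≤ Real.exp (τ + 256 * c ^ 2 * τ ^ 2) := by
  have hint : Integrable (fun ω => Z ω ^ 2) P := (h.memLp 2).integrable_sq
  have hc' : (0 : ℝ) < c := hc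
  have hint' : Integrable (fun ω => 1 + τ * Z ω ^ 2) P :=
    (integrable_const _).add (hint.const_mul _)
  have hexp := (h.integrable_exp_sq hZ hc).const_mul (128 * c ^ 2 * τ ^ 2)
  calc mgf (fun ω => Z ω ^ 2) P τ
      ≤ ∫ ω, (1 + τ * Z ω ^ 2 + 128 * c ^ 2 * τ ^ 2 * Real.exp (Z ω ^ 2 / (4 * c))) ∂P :=
        integral_mono (h.integrable_exp_mul_sq hZ hc hτ)
          (hint'.add hexp)
          fun ω => exp_mul_le_of_abs_le hc' (sq_nonneg _) hτ
    _ = 1 + τ + 128 * c ^ 2 * τ ^ 2 * ∫ ω, Real.exp (Z ω ^ 2 / (4 * c)) ∂P := by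
        rw [integral_add hint' hexp, integral_add (integrable_const _)
          (hint.const_mul _), integral_const_mul, integral_const_mul, h.integral_sq, hvar]
        simp
    _ ≤ 1 + τ + 128 * c ^ 2 * τ ^ 2 * 2 := by
        gcongr
        exact h.integral_exp_sq_le hZ hc
    _ ≤ _ := by
        have := Real.add_one_le_exp (τ + 256 * c ^ 2 * τ ^ 2)
        linarith

/-- Concentration of the sum of squares of independent subgaussian variables of variance `1`. -/
lemma measureReal_abs_sum_sq_sub_le {m : ℕ} {Z : Fin m → Ω → ℝ} {c : ℝ≥0} (hc : 1 ≤ c)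
    (hindep : iIndepFun Z P) (hZ : ∀ i, Measurable (Z i))
    (hsub : ∀ i, HasSubgaussianMGF (Z i) c P) (hvar : ∀ i, Var[Z i; P] = 1) {η : ℝ}
    (hη : 0 < η) (hη1 : η < 1) :
    P.real {ω | m * η < |∑ i, Z i ω ^ 2 - m|} ≤
      2 * Real.exp (-(m * ((1024 * (c : ℝ) ^ 2)⁻¹ * η ^ 2))) := by
  have hc' : (1 : ℝ) ≤ c := hc
  have hc0 : 0 < c := one_pos.trans_le hc
  have hind2 : iIndepFun (fun i ω => Z i ω ^ 2) P :=
    hindep.comp (fun _ x => x ^ 2) fun _ => by fun_prop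
  -- This `s` minimizes the Chernoff exponent `256 c² s² - s η`; `c ≥ 1` keeps it in the range `s ≤
  -- 1 / (8c)`.
  set s : ℝ := η / (512 * c ^ 2) with hs
  have hs0 : 0 < s := by positivity
  have hs8 : s ≤ 1 / (8 * c) := by
    rw [hs, div_le_div_iff₀ (by positivity) (by positivity)]
    nlinarith
  have hval : 256 * c ^ 2 * s ^ 2 - s * η = -((1024 * (c : ℝ) ^ 2)⁻¹ * η ^ 2) := by
    rw [hs]; field_simp; ring
  have hmgf : ∀ τ : ℝ, |τ| ≤ 1 / (8 * c) →
      mgf (fun ω => ∑ i, Z i ω ^ 2) P τ ≤ Real.exp (m * (τ + 256 * c ^ 2 * τ ^ 2)) := by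
    intro τ hτ
    have h1 := hind2.mgf_sum (t := τ) (fun i => by fun_prop) Finset.univ
    have h2 : (∑ i, fun ω => Z i ω ^ 2) = fun ω => ∑ i, Z i ω ^ 2 := by
      ext ω; simp
    rw [h2] at h1
    rw [h1]
    calc _ ≤ ∏ _i : Fin m, Real.exp (τ + 256 * c ^ 2 * τ ^ 2) :=
          Finset.prod_le_prod (fun i _ => mgf_nonneg)
            fun i _ => (hsub i).mgf_sq_le (hZ i) hc0 (hvar i) hτ
      _ = _ := by simp [← Real.exp_nat_mul]
  have hint : ∀ τ : ℝ, |τ| ≤ 1 / (8 * c) →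
      Integrable (fun ω => Real.exp (τ * ∑ i, Z i ω ^ 2)) P := by
    intro τ hτ
    have h1 := hind2.integrable_exp_mul_sum (t := τ) (s := Finset.univ) (fun i => by fun_prop)
      fun i _ => (hsub i).integrable_exp_mul_sq (hZ i) hc0 hτ
    simpa using h1
  have hsa : |s| ≤ 1 / (8 * c) := by rwa [abs_of_pos hs0]
  have hsa' : |-s| ≤ 1 / (8 * c) := by rwa [abs_neg]
  have hup := (measure_ge_le_exp_mul_mgf (m * (1 + η)) hs0.le (hint s hsa)).trans
    (mul_le_mul_of_nonneg_left (hmgf s hsa) (Real.exp_pos _).le)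
  have hlo := (measure_le_le_exp_mul_mgf (m * (1 - η)) (neg_nonpos.2 hs0.le) (hint _ hsa')).trans
    (mul_le_mul_of_nonneg_left (hmgf _ hsa') (Real.exp_pos _).le)
  rw [← Real.exp_add] at hup hlo
  have e1 : -s * (m * (1 + η)) + m * (s + 256 * c ^ 2 * s ^ 2) =
      -(m * ((1024 * (c : ℝ) ^ 2)⁻¹ * η ^ 2)) := by rw [← mul_neg, ← hval]; ring
  have e2 : -(-s) * (m * (1 - η)) + m * (-s + 256 * c ^ 2 * (-s) ^ 2) =
      -(m * ((1024 * (c : ℝ) ^ 2)⁻¹ * η ^ 2)) := by rw [← mul_neg, ← hval]; ring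
  rw [e1] at hup
  rw [e2] at hlo
  calc _ ≤ P.real ({ω | m * (1 + η) ≤ ∑ i, Z i ω ^ 2} ∪ {ω | ∑ i, Z i ω ^ 2 ≤ m * (1 - η)}) := by
        refine measureReal_mono fun ω hω => ?_
        rw [Set.mem_ofPred_eq, lt_abs] at hω
        rcases hω with hω | hω
        · left; rw [Set.mem_ofPred_eq]; linarith
        · right; rw [Set.mem_ofPred_eq]; linarith
    _ ≤ _ := (measureReal_union_le _ _).trans (by linarith)

/-- The rows of a matrix with independent entries are independent. -/
lemma iIndepFun_rows {ι κ : Type*} [Countable ι] [Countable κ] {X : ι → κ → Ω → ℝ}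
    (hX : ∀ i j, Measurable (X i j)) (h : iIndepFun (fun (p : ι × κ) ω => X p.1 p.2 ω) P) :
    iIndepFun (fun i ω j => X i j ω) P := by
  have hpr : ∀ i j, IsProbabilityMeasure (P.map (X i j)) :=
    fun i j => Measure.isProbabilityMeasure_map (hX i j).aemeasurable
  have hrow : ∀ i, iIndepFun (X i) P := fun i =>
    h.precomp (g := fun j => (i, j)) fun _ _ h => (Prod.mk.inj h).2
  rw [iIndepFun_iff_map_fun_eq_infinitePi_map (fun i => by fun_prop)]
  have h1 := (iIndepFun_iff_map_fun_eq_infinitePi_map (fun p : ι × κ => hX p.1 p.2)).1 h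
  -- Currying turns the product law over pairs into a product over rows of product laws.
  have h2 := congrArg (Measure.map (MeasurableEquiv.curry ι κ ℝ)) h1
  rw [Measure.map_map (by fun_prop) (by fun_prop),
    Measure.infinitePi_map_curry (fun i j => P.map (X i j))] at h2
  refine h2.trans ?_
  congr 1
  ext1 i
  exact ((iIndepFun_iff_map_fun_eq_infinitePi_map (hX i)).1 (hrow i)).symm

/-- A matrix with i.i.d. subgaussian entries has the distributional JL property. -/
theorem IsScaledSubgaussian.distributionalJL {m N : ℕ} {c : ℝ≥0}
    {Φ : Ω → Matrix (Fin m) (Fin N) ℝ} (hm : ∀ i j, Measurable fun ω => Φ ω i j)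
    (h : IsScaledSubgaussian P c Φ) :
    DistributionalJL P (fun η => (1024 * ((max c 1 : ℝ≥0) : ℝ) ^ 2)⁻¹ * η ^ 2) Φ := by
  intro x η hη hη1
  rcases Nat.eq_zero_or_pos m with rfl | hmpos
  · refine measureReal_le_one.trans ?_
    norm_num
  have hmR : (0 : ℝ) < m := by exact_mod_cast hmpos
  rcases eq_or_ne x 0 with rfl | hx
  · simp [l2norm, Real.exp_nonneg]
  have hpos : 0 < x ⬝ᵥ x := lt_of_le_of_ne (dotProduct_self_nonneg_real x)
    fun h => hx (dotProduct_self_eq_zero.1 h.symm)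
  set r := √(x ⬝ᵥ x) with hr
  have hr0 : 0 < r := Real.sqrt_pos.2 hpos
  have hrr : r ^ 2 = x ⬝ᵥ x := Real.sq_sqrt hpos.le
  set u : Fin N → ℝ := fun j => x j / r with hu
  have huu : ∑ j, u j ^ 2 = 1 := by
    simp only [hu, div_pow, ← Finset.sum_div, hrr]
    rw [div_eq_one_iff_eq hpos.ne']
    simp [dotProduct, sq]
  have hentry : iIndepFun (fun (p : Fin m × Fin N) ω => u p.2 * (√(m : ℝ) * Φ ω p.1 p.2)) P :=
    h.indep.comp (fun p y => u p.2 * (√(m : ℝ) * y)) fun p => by fun_prop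
  -- For the unit vector `u = x / r`, the rows give independent `Z i` of variance `1` and proxy `c ∑
  -- u_j² = c`, and `m ‖Φ x‖² = ‖x‖² ∑ Z_i²`.
  set Z : Fin m → Ω → ℝ := fun i ω => ∑ j, u j * (√(m : ℝ) * Φ ω i j) with hZ
  have hZm : ∀ i, Measurable (Z i) := fun i =>
    Finset.measurable_sum _ fun j _ => ((hm i j).const_mul _).const_mul _
  have hZind : iIndepFun Z P :=
    (iIndepFun_rows (X := fun i j ω => u j * (√(m : ℝ) * Φ ω i j))
      (fun i j => ((hm i j).const_mul _).const_mul _) hentry).comp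
      (fun _ v => ∑ j, v j) fun _ => by fun_prop
  have hrow : ∀ i, iIndepFun (fun j ω => u j * (√(m : ℝ) * Φ ω i j)) P := fun i =>
    hentry.precomp (g := fun j => (i, j)) fun _ _ h => (Prod.mk.inj h).2
  have hsubE : ∀ i j, HasSubgaussianMGF (fun ω => u j * (√(m : ℝ) * Φ ω i j))
      ((u j ^ 2).toNNReal * c) P := fun i j => by
    rw [Real.toNNReal_of_nonneg (sq_nonneg (u j))]
    exact (h.subgaussian i j).const_mul (u j)
  have hZsub : ∀ i, HasSubgaussianMGF (Z i) (max c 1) P := fun i => by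
    refine (HasSubgaussianMGF.sum_of_iIndepFun (hrow i) fun j _ => hsubE i j).mono ?_
    rw [← Finset.sum_mul]
    have : ∑ j, (u j ^ 2).toNNReal = 1 := by
      rw [← Real.toNNReal_sum_of_nonneg fun j _ => sq_nonneg _, huu, Real.toNNReal_one]
    rw [this, one_mul]
    exact le_max_left _ _
  have hZvar : ∀ i, Var[Z i; P] = 1 := fun i => by
    have h1 := IndepFun.variance_sum (μ := P) (s := Finset.univ)
      (X := fun j ω => u j * (√(m : ℝ) * Φ ω i j)) (fun j _ => (hsubE i j).memLp 2)
      (fun j _ j' _ hjj => (hrow i).indepFun hjj)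
    have h2 : (∑ j, fun ω => u j * (√(m : ℝ) * Φ ω i j)) = Z i := by
      ext ω; simp [hZ]
    rw [h2] at h1
    rw [h1, ← huu]
    refine Finset.sum_congr rfl fun j _ => ?_
    rw [variance_const_mul, h.variance_eq_one, mul_one]
  refine le_trans (le_of_eq ?_)
    (measureReal_abs_sum_sq_sub_le (le_max_right c 1) hZind hZm hZsub hZvar hη hη1)
  congr 1
  ext ω
  have hnorm : m * (l2norm (Φ ω *ᵥ x) ^ 2) = (x ⬝ᵥ x) * ∑ i, Z i ω ^ 2 := by
    rw [l2norm_sq, dotProduct, Finset.mul_sum, Finset.mul_sum]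
    refine Finset.sum_congr rfl fun i _ => ?_
    have : Z i ω = √(m : ℝ) / r * (Φ ω *ᵥ x) i := by
      simp only [hZ, hu, Matrix.mulVec, dotProduct, Finset.mul_sum]
      exact Finset.sum_congr rfl fun j _ => by ring
    rw [this, mul_pow, div_pow, Real.sq_sqrt hmR.le, hrr]
    field_simp
  have habs : m * |l2norm (Φ ω *ᵥ x) ^ 2 - x ⬝ᵥ x| = (x ⬝ᵥ x) * |∑ i, Z i ω ^ 2 - m| := by
    rw [← abs_of_pos hmR, ← abs_mul, abs_of_pos hmR, mul_sub, hnorm, mul_comm (m : ℝ) (x ⬝ᵥ x),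
      ← mul_sub, abs_mul, abs_of_pos hpos]
  rw [Set.mem_ofPred_eq, Set.mem_ofPred_eq, l2norm_sq x, ← mul_lt_mul_iff_right₀ hmR, habs,
    mul_comm η, mul_left_comm, mul_lt_mul_iff_right₀ hpos]

end Subgaussian

/-! ### Union bound and choice of the constant. -/

lemma IsNearIsometry.mono {m k : ℕ} {ε ε' : ℝ} {A : Matrix (Fin m) (Fin k) ℝ}
    (hA : IsNearIsometry ε A) (h : ε ≤ ε') : IsNearIsometry ε' A := fun x =>
  (hA x).trans (mul_le_mul_of_nonneg_right h (dotProduct_self_nonneg_real x))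

/-- A random matrix with the distributional JL property is a near isometry on a fixed
`k`-dimensional subspace with high probability. -/
lemma DistributionalJL.exists_event {Ω : Type*} [MeasurableSpace Ω] {P : Measure Ω}
    [IsProbabilityMeasure P] {m N k : ℕ} {f : ℝ → ℝ} {Φ : Ω → Matrix (Fin m) (Fin N) ℝ}
    (h : DistributionalJL P f Φ) (hm : ∀ i j, Measurable fun ω => Φ ω i j)
    {U : Matrix (Fin N) (Fin k) ℝ} (hU : Uᵀ * U = 1) {η : ℝ} (hη : 0 < η) (hη1 : η < 1) :
    ∃ E : Set Ω, MeasurableSet E ∧ 1 - 25 ^ k * (2 * Real.exp (-(m * f η))) ≤ P.real E ∧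
      ∀ ω ∈ E, IsNearIsometry (4 * η) (Φ ω * U) := by
  obtain ⟨T, hT, hnet⟩ := exists_quarter_net k
  let bad : (Fin k → ℝ) → Set Ω := fun y => {ω | η * l2norm (U *ᵥ y) ^ 2 <
    |l2norm (Φ ω *ᵥ (U *ᵥ y)) ^ 2 - l2norm (U *ᵥ y) ^ 2|}
  have hbad : ∀ y, MeasurableSet (bad y) := fun y => by
    refine measurableSet_lt measurable_const ?_
    simp only [l2norm_sq, dotProduct, Matrix.mulVec]
    fun_prop
  refine ⟨(⋃ y ∈ T, bad y)ᶜ, (T.measurableSet_biUnion fun y _ => hbad y).compl, ?_, ?_⟩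
  · rw [probReal_compl_eq_one_sub (T.measurableSet_biUnion fun y _ => hbad y)]
    refine sub_le_sub_left ((measureReal_biUnion_finset_le T bad).trans ?_) 1
    calc ∑ y ∈ T, P.real (bad y) ≤ ∑ _y ∈ T, 2 * Real.exp (-(m * f η)) :=
          Finset.sum_le_sum fun y _ => h _ η hη hη1
      _ = T.card * (2 * Real.exp (-(m * f η))) := by rw [Finset.sum_const, nsmul_eq_mul]
      _ ≤ _ := by
        gcongr
        exact_mod_cast hT
  · intro ω hω
    refine isNearIsometry_of_net (T := (T : Set (Fin k → ℝ))) hnet hη.le fun y hy => ?_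
    have h1 : ω ∉ bad y := fun hb => hω (Set.mem_biUnion (Finset.mem_coe.1 hy) hb)
    simp only [bad, Set.mem_ofPred_eq, not_lt, l2norm_sq,
      dotProduct_mulVec_of_orthonormal hU] at h1
    rwa [← Matrix.mulVec_mulVec]

lemma IsQuadraticRate.exists_mul_sq_le {f : ℝ → ℝ} (hf : IsQuadraticRate f) :
    ∃ a r : ℝ, 0 < a ∧ 0 < r ∧ r ≤ 1 ∧ ∀ η, 0 < η → η < r → a * η ^ 2 ≤ f η := by
  obtain ⟨K, hK, hO⟩ := hf.2.2.exists_pos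
  rw [isBigOWith_iff, eventually_nhdsWithin_iff, Metric.eventually_nhds_iff] at hO
  obtain ⟨r, hr, hO⟩ := hO
  refine ⟨K⁻¹, min r 1, inv_pos.2 hK, lt_min hr one_pos, min_le_right _ _, fun η hη hηr => ?_⟩
  have h1 := hO (y := η) (by
    rw [Real.dist_eq, sub_zero, abs_of_pos hη]
    exact hηr.trans_le (min_le_left _ _)) hη
  have h2 := hf.1 η hη (hηr.trans_le (min_le_right _ _))
  rw [Real.norm_of_nonneg (sq_nonneg _), Real.norm_of_nonneg h2.le] at h1
  rwa [inv_mul_le_iff₀ hK]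

lemma isQuadraticRate_mul_sq {a : ℝ} (ha : 0 < a) : IsQuadraticRate fun η => a * η ^ 2 :=
  ⟨fun η hη _ => by positivity,
    (isTheta_const_mul_left ha.ne').2 (isTheta_refl _ _)⟩

/-- With `L = log (1 / (ε δ))`, the hypothesis `ε δ ≤ ρ` gives `L ≥ log (1 / ρ)`, so a multiple of
`L` pays for `log 50`. As `25 ^ k * 2 ≤ 50 ^ k` for `k ≥ 1`, the failure probability is at most `exp
(-2L) < ε δ < δ`. -/
lemma failure_probability_lt {k : ℕ} (hk : 0 < k) {ρ ε δ b M : ℝ} (hρ : 0 < ρ) (hρ1 : ρ < 1)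
    (hε : 0 < ε) (hε1 : ε < 1) (hδ : 0 < δ) (hεδ : ε * δ ≤ ρ) (hb : 0 < b)
    (hM : (2 + Real.log 50 / Real.log (1 / ρ)) / b *
      (k * (ε ^ 2)⁻¹ * (Real.log (1 / ε) + Real.log (1 / δ))) * (b * ε ^ 2) ≤ M) :
    25 ^ k * (2 * Real.exp (-M)) < δ := by
  have hk1 : (1 : ℝ) ≤ k := by exact_mod_cast hk
  set L := Real.log (1 / ε) + Real.log (1 / δ) with hL
  have hLeq : L = -Real.log (ε * δ) := by
    rw [hL, Real.log_mul hε.ne' hδ.ne', one_div, one_div, Real.log_inv, Real.log_inv]; ring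
  have hL0 : 0 < Real.log (1 / ρ) := Real.log_pos (by rw [lt_div_iff₀ hρ]; linarith)
  have hLL : Real.log (1 / ρ) ≤ L := by
    rw [hLeq, one_div, Real.log_inv]
    exact neg_le_neg (Real.log_le_log (by positivity) hεδ)
  have h50 : 0 < Real.log 50 := Real.log_pos (by norm_num)
  have h1 : (2 + Real.log 50 / Real.log (1 / ρ)) / b * (k * (ε ^ 2)⁻¹ * L) * (b * ε ^ 2) =
      k * (2 * L + Real.log 50 * (L / Real.log (1 / ρ))) := by
    field_simp
  have h2 : Real.log 50 ≤ Real.log 50 * (L / Real.log (1 / ρ)) :=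
    le_mul_of_one_le_right h50.le ((one_le_div hL0).2 hLL)
  have h3 : k * Real.log 50 + 2 * L ≤ M := by
    refine le_trans ?_ (h1.ge.trans hM)
    nlinarith
  have h4 : (25 : ℝ) ^ k * 2 ≤ Real.exp (k * Real.log 50) := by
    rw [Real.exp_nat_mul, Real.exp_log (by norm_num), show (50 : ℝ) = 25 * 2 by norm_num, mul_pow]
    gcongr
    exact le_self_pow₀ (by norm_num) hk.ne'
  calc 25 ^ k * (2 * Real.exp (-M)) = 25 ^ k * 2 * Real.exp (-M) := by ring
    _ ≤ Real.exp (k * Real.log 50) * Real.exp (-M) := by gcongr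
    _ ≤ Real.exp (-(2 * L)) := by
      rw [← Real.exp_add, Real.exp_le_exp]; linarith
    _ < Real.exp (-L) := Real.exp_lt_exp.2 (by linarith)
    _ = ε * δ := by rw [hLeq, neg_neg, Real.exp_log (by positivity)]
    _ < δ := by nlinarith

theorem exists_const_forall_sketchPreserves {f : ℝ → ℝ} (hf : IsQuadraticRate f) {ρ : ℝ}
    (hρ : 0 < ρ) (hρ1 : ρ < 1) : ∃ C : ℝ, 0 < C ∧
      ∀ (N n k m : ℕ) (X : Matrix (Fin N) (Fin n) ℝ) (U : Matrix (Fin N) (Fin k) ℝ)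
        (σ : Fin k → ℝ) (V : Matrix (Fin n) (Fin k) ℝ) (ε δ : ℝ)
        (Ω : Type*) [MeasurableSpace Ω] (P : Measure Ω) [IsProbabilityMeasure P]
        (Φ : Ω → Matrix (Fin m) (Fin N) ℝ),
        X.rank = k → IsTruncatedSVD X U σ V →
        0 < ε → ε < 1 → 0 < δ → ε * δ ≤ ρ →
        (∀ i j, Measurable fun ω => Φ ω i j) → DistributionalJL P f Φ →
        C * (k * (ε ^ 2)⁻¹ * (Real.log (1 / ε) + Real.log (1 / δ))) ≤ m →
        HoldsWithProbExceeding P (1 - δ) fun ω => SketchPreserves ε σ V (Φ ω * X) := by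
  obtain ⟨a, r, ha, hr, hr1, har⟩ := hf.exists_mul_sq_le
  have hL0 : 0 < Real.log (1 / ρ) := Real.log_pos (by rw [lt_div_iff₀ hρ]; linarith)
  have h50 : 0 < Real.log 50 := Real.log_pos (by norm_num)
  refine ⟨(2 + Real.log 50 / Real.log (1 / ρ)) / (a * (r / 4) ^ 2), by positivity, ?_⟩
  intro N n k m X U σ V ε δ Ω _ P _ Φ hX hsvd hε hε1 hδ hεδ hm hJL hmC
  have hpres : ∀ ω, IsNearIsometry ε (Φ ω * U) → SketchPreserves ε σ V (Φ ω * X) := by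
    intro ω hω
    have := hω.sketchPreserves hε hε1 hsvd.right_orthonormal hsvd.antitone (hsvd.pos_of_rank_eq hX)
    rwa [Matrix.mul_assoc, ← Matrix.mul_assoc U, ← hsvd.eq_mul] at this
  rcases Nat.eq_zero_or_pos k with rfl | hk
  -- For `k = 0` the union bound does not help (`m` may be `0`), but every matrix is a near isometry
  -- on `ℝ ^ 0`.
  · refine ⟨Set.univ, MeasurableSet.univ, by simpa using hδ, fun ω _ => hpres ω fun x => ?_⟩
    rw [Subsingleton.elim x 0]
    simp
  -- The net costs a factor `4`, which `η = r ε / 4` compensates; the factor `r` keeps `η < r`,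
  -- where `f η ≥ a η²`.
  obtain ⟨E, hE, hPE, hEω⟩ := hJL.exists_event hm hsvd.left_orthonormal (η := r / 4 * ε)
    (by positivity) (by nlinarith)
  refine ⟨E, hE, lt_of_lt_of_le (sub_lt_sub_left ?_ 1) hPE, fun ω hω => hpres ω
    ((hEω ω hω).mono (by nlinarith))⟩
  refine failure_probability_lt hk hρ hρ1 hε hε1 hδ hεδ (by positivity : 0 < a * (r / 4) ^ 2) ?_
  refine mul_le_mul hmC ?_ (by positivity) (Nat.cast_nonneg m)
  refine le_trans (le_of_eq (by ring)) (har (r / 4 * ε) (by positivity) (by nlinarith))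
theorem mainTheorem3 :
    (∀ c : ℝ≥0, ∀ ρ : ℝ, 0 < ρ → ρ < 1 → ∃ C : ℝ, 0 < C ∧
      ∀ (N n k m : ℕ) (X : Matrix (Fin N) (Fin n) ℝ) (U : Matrix (Fin N) (Fin k) ℝ)
        (σ : Fin k → ℝ) (V : Matrix (Fin n) (Fin k) ℝ) (ε δ : ℝ)
        (Ω : Type*) [MeasurableSpace Ω] (P : Measure Ω) [IsProbabilityMeasure P]
        (Φ : Ω → Matrix (Fin m) (Fin N) ℝ),
        n ≤ N → X.rank = k → IsTruncatedSVD X U σ V →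
        0 < ε → ε < 1 → 0 < δ → δ < 1 → ε * δ ≤ ρ →
        (∀ i j, Measurable fun ω => Φ ω i j) → IsScaledSubgaussian P c Φ →
        C * (k * (ε ^ 2)⁻¹ * (Real.log (1 / ε) + Real.log (1 / δ))) ≤ m →
        HoldsWithProbExceeding P (1 - δ) fun ω => SketchPreserves ε σ V (Φ ω * X)) ∧
    (∀ f : ℝ → ℝ, IsQuadraticRate f → ∀ ρ : ℝ, 0 < ρ → ρ < 1 → ∃ C : ℝ, 0 < C ∧
      ∀ (N n k m : ℕ) (X : Matrix (Fin N) (Fin n) ℝ) (U : Matrix (Fin N) (Fin k) ℝ)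
        (σ : Fin k → ℝ) (V : Matrix (Fin n) (Fin k) ℝ) (ε δ : ℝ)
        (Ω : Type*) [MeasurableSpace Ω] (P : Measure Ω) [IsProbabilityMeasure P]
        (Φ : Ω → Matrix (Fin m) (Fin N) ℝ),
        n ≤ N → X.rank = k → IsTruncatedSVD X U σ V →
        0 < ε → ε < 1 → 0 < δ → δ < 1 → ε * δ ≤ ρ →
        (∀ i j, Measurable fun ω => Φ ω i j) → DistributionalJL P f Φ →
        C * (k * (ε ^ 2)⁻¹ * (Real.log (1 / ε) + Real.log (1 / δ))) ≤ m →
        HoldsWithProbExceeding P (1 - δ) fun ω => SketchPreserves ε σ V (Φ ω * X))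
 := by
  constructor
  · intro c ρ hρ hρ1
    have hc : (0 : ℝ) < ((max c 1 : ℝ≥0) : ℝ) :=
      one_pos.trans_le (NNReal.coe_le_coe.2 (le_max_right c 1))
    obtain ⟨C, hC, h⟩ := exists_const_forall_sketchPreserves
      (isQuadraticRate_mul_sq (a := (1024 * ((max c 1 : ℝ≥0) : ℝ) ^ 2)⁻¹) (by positivity)) hρ hρ1
    exact ⟨C, hC, fun N n k m X U σ V ε δ Ω _ P _ Φ _ hX hsvd hε hε1 hδ _ hεδ hm hΦ hmC =>
      h N n k m X U σ V ε δ Ω P Φ hX hsvd hε hε1 hδ hεδ hm (hΦ.distributionalJL hm) hmC⟩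
  · intro f hf ρ hρ hρ1
    obtain ⟨C, hC, h⟩ := exists_const_forall_sketchPreserves hf hρ hρ1
    exact ⟨C, hC, fun N n k m X U σ V ε δ Ω _ P _ Φ _ hX hsvd hε hε1 hδ _ hεδ hm hΦ hmC =>
      h N n k m X U σ V ε δ Ω P Φ hX hsvd hε hε1 hδ hεδ hm hΦ hmC⟩
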